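/- Let $C\subseteq\mathbb F_2^n$ be a binary linear code of dimension $k>1$, and let $A_d$ be the number of its codewords of Hamming weight $d$. The codewords, equiprobable, are BPSK modulated ($s_t=1-2c_t$), sent over an AWGN channel whose noise $z\in\mathbb R^n$ has independent $N(0,\sigma^2)$ coordinates, $\sigma>0$, and decoded by a maximum-likelihood (nearest-codeword) decoder, with any rule for ties; $\Pr\{E\}$ is the probability of a decoding error. For $r\ge 0$ put $$g(r)=\frac{2r^{n-1}e^{-r^2/(2\sigma^2)}}{2^{n/2}\sigma^n\Gamma(n/2)},\qquad f_u(r)=\sum_{d=1}^nA_d\,p_2(r,d),$$ $$p_2(r,d)=\frac{\Gamma(n/2)}{\sqrt\pi\,\Gamma((n-1)/2)}\int_0^{\arccos(\sqrt d/r)}\sin^{n-2}\phi\,d\phi\ \text{ if } r>\sqrt d,\qquad p_2(r,d)=0\ \text{ if } r\le\sqrt d .$$ Then the equation $f_u(r)=1$ has a unique solution $r_1>0$; it depends on the code only, not on $\sigma$ (that is, not on the SNR). For every $\sigma>0$, $$\Pr\{E\}\le \mathrm{SB}(r_1),\qquad \mathrm{SB}(\rho):=\int_0^{\rho}f_u(r)g(r)\,dr+\int_{\rho}^\infty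 g(r)\,dr ,$$ and $\mathrm{SB}(r_1)=\min_{\rho\ge0}\mathrm{SB}(\rho)$. Moreover: (a) (Reduction of the generalized sphere bound.) For a finite code $S\subset\mathbb R^n$ with $M$ codewords, let $A_\delta$ be $1/M$ times the number of ordered pairs of codewords at Euclidean distance $\delta$, and let the generalized sphere bound be $\int_0^\infty\min\{\sum_{\delta>0}A_\delta\,\tilde p_2(r,\delta),1\}\,g(r)\,dr$, where $\tilde p_2(r,\delta)$ is given by the formula for $p_2(r,d)$ with $\sqrt d$ replaced by $\delta/2$. When $S$ is the set of BPSK images of the codewords of $C$, $\sum_{\delta>0}A_\delta\tilde p_2(r,\delta)=f_u(r)$ for all $r$, and the generalized sphere bound equals $\mathrm{SB}(r_1)$. (b) (Kasami et al.) $\mathrm{SB}(r_1)$ equals the sphere bound of Kasami et al., $\int_0^\infty\min\{f_u(r),1\}\,g(r)\,dr$. (c) (Herzberg–Poltyrev.) For every $\rho\ge0$, $\mathrm{SB}(\rho)$ equals the bound of Herzberg and Poltyrev with radius $\rho$, $$\sum_{d\ge1,\ \sqrt d<\rho}A_d\int_{\sqrt d}^{\rho}\int_{z^2}^{\rho^2}f_{Z_1,Y}(z,y)\,dy\,dz+\int_{\rho^2}^\infty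 f_Y(y)\,dy,$$ $$f_{Z_1,Y}(z,y)=\frac{(y-z^2)^{(n-3)/2}e^{-y/(2\sigma^2)}}{\sqrt\pi\,2^{n/2}\sigma^n\Gamma((n-1)/2)},\qquad f_Y(y)=\frac{y^{n/2-1}e^{-y/(2\sigma^2)}}{2^{n/2}\sigma^n\Gamma(n/2)},$$ and $f_u(r)=1$ is equivalent to their equation for the optimal radius, $$\sum_{d\ge1,\ \sqrt d<r}A_d\int_0^{\arccos(\sqrt d/r)}\sin^{n-2}\phi\,d\phi=\frac{\sqrt\pi\,\Gamma((n-1)/2)}{\Gamma(n/2)} .$$ In particular, $\mathrm{SB}(r_1)$ is their bound at the optimal radius. -/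

import Mathlib

open MeasureTheory ProbabilityTheory

noncomputable section

namespace SphereBound

/-! ### General codes, the additive white Gaussian noise channel, nearest-codeword decoding -/

/-- The law of a noise vector with `n` independent Gaussian coordinates of mean `0` and
variance `σ ^ 2`. -/
def noise (n : ℕ) (σ : ℝ) : Measure (EuclideanSpace ℝ (Fin n)) :=
  (Measure.pi fun _ : Fin n => gaussianReal 0 (Real.toNNReal (σ ^ 2))).map (WithLp.toLp 2)

/-- `dec` is a maximum-likelihood decoder of the code `S`: it returns a codeword nearest to the
received vector. Ties may be broken in any way. -/
def IsMLDecoder {n : ℕ} (S : Finset (EuclideanSpace ℝ (Fin n)))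
    (dec : EuclideanSpace ℝ (Fin n) → EuclideanSpace ℝ (Fin n)) : Prop :=
  ∀ y, dec y ∈ S ∧ ∀ s ∈ S, ‖y - dec y‖ ≤ ‖y - s‖

/-- The decoding error probability: the average over equiprobable codewords `s` of the
probability that the received vector `s + z` is not decoded to `s`. -/
def errorProb {n : ℕ} (S : Finset (EuclideanSpace ℝ (Fin n)))
    (dec : EuclideanSpace ℝ (Fin n) → EuclideanSpace ℝ (Fin n)) (σ : ℝ) : ℝ :=
  ∑ s ∈ S, (1 / (S.card : ℝ)) * (noise n σ).real {z | dec (s + z) ≠ s}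

/-- The density of the norm of the noise vector, at a radius `r ≥ 0`. -/
def radiusPdf (n : ℕ) (σ r : ℝ) : ℝ :=
  2 * r ^ (n - 1) * Real.exp (-r ^ 2 / (2 * σ ^ 2)) /
    ((2 : ℝ) ^ ((n : ℝ) / 2) * σ ^ n * Real.Gamma ((n : ℝ) / 2))

/-! ### The sphere bound of a general code (in dimension `n ≥ 2`) -/

/-- The pairwise error probability of two codewords at Euclidean distance `δ`, conditional on the
noise vector having norm `r`: the fraction of a sphere of radius `r` that is covered by the
spherical cap at distance `δ / 2` from the centre. -/
def pairwise (n : ℕ) (r δ : ℝ) : ℝ :=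
  if δ / 2 < r then
    Real.Gamma ((n : ℝ) / 2) / (Real.sqrt Real.pi * Real.Gamma (((n : ℝ) - 1) / 2)) *
      ∫ φ in (0 : ℝ)..Real.arccos (δ / (2 * r)), Real.sin φ ^ (n - 2)
  else 0

open scoped Classical in
/-- The number of codewords at Euclidean distance `δ` from `s`. -/
def distCount {n : ℕ} (S : Finset (EuclideanSpace ℝ (Fin n))) (δ : ℝ)
    (s : EuclideanSpace ℝ (Fin n)) : ℕ :=
  (S.filter fun t => dist s t = δ).card

/-- The Euclidean distance spectrum: the average of `distCount S δ s` over the codewords `s`. -/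
def distSpectrum {n : ℕ} (S : Finset (EuclideanSpace ℝ (Fin n))) (δ : ℝ) : ℝ :=
  ∑ s ∈ S, (1 / (S.card : ℝ)) * (distCount S δ s : ℝ)

open scoped Classical in
/-- The finite set of distances between distinct codewords. -/
def distances {n : ℕ} (S : Finset (EuclideanSpace ℝ (Fin n))) : Finset ℝ :=
  S.offDiag.image fun p => dist p.1 p.2

/-- The averaged conditional union bound of a general code. -/
def generalUnionBound {n : ℕ} (S : Finset (EuclideanSpace ℝ (Fin n))) (r : ℝ) : ℝ :=
  ∑ δ ∈ distances S, distSpectrum S δ * pairwise n r δ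

/-- The generalized sphere bound of a general code. -/
def generalSphereBound {n : ℕ} (S : Finset (EuclideanSpace ℝ (Fin n))) (σ : ℝ) : ℝ :=
  ∫ r in Set.Ioi (0 : ℝ), min (generalUnionBound S r) 1 * radiusPdf n σ r

/-! ### Binary linear codes with BPSK modulation -/

/-- The bipolar image of a binary word: `0 ↦ 1` and `1 ↦ -1` in every coordinate. -/
def bpsk {n : ℕ} (c : Fin n → ZMod 2) : EuclideanSpace ℝ (Fin n) :=
  WithLp.toLp 2 fun t => 1 - 2 * ((c t).val : ℝ)

open scoped Classical in
/-- The set of bipolar images of the codewords of a binary linear code. -/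
def bpskCode {n : ℕ} (C : Submodule (ZMod 2) (Fin n → ZMod 2)) :
    Finset (EuclideanSpace ℝ (Fin n)) :=
  (Finset.univ.filter fun c : Fin n → ZMod 2 => c ∈ C).image bpsk

open scoped Classical in
/-- The weight distribution: the number of codewords of Hamming weight `d`. -/
def weightDist {n : ℕ} (C : Submodule (ZMod 2) (Fin n → ZMod 2)) (d : ℕ) : ℕ :=
  (Finset.univ.filter fun c : Fin n → ZMod 2 => c ∈ C ∧ hammingNorm c = d).card

/-- The conditional pairwise error probability at Hamming distance `d` and noise norm `r`. -/
def p₂ (n : ℕ) (r : ℝ) (d : ℕ) : ℝ :=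
  if Real.sqrt d < r then
    Real.Gamma ((n : ℝ) / 2) / (Real.sqrt Real.pi * Real.Gamma (((n : ℝ) - 1) / 2)) *
      ∫ φ in (0 : ℝ)..Real.arccos (Real.sqrt d / r), Real.sin φ ^ (n - 2)
  else 0

/-- The conditional union bound `f_u` of a binary linear code. -/
def unionBound {n : ℕ} (C : Submodule (ZMod 2) (Fin n → ZMod 2)) (r : ℝ) : ℝ :=
  ∑ d ∈ Finset.Icc 1 n, (weightDist C d : ℝ) * p₂ n r d

/-- The sphere bound with the Gallager region a ball of radius `ρ`:
`∫₀^ρ f_u g + ∫_ρ^∞ g`. -/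
def sphereBound {n : ℕ} (C : Submodule (ZMod 2) (Fin n → ZMod 2)) (σ ρ : ℝ) : ℝ :=
  (∫ r in (0 : ℝ)..ρ, unionBound C r * radiusPdf n σ r) + ∫ r in Set.Ioi ρ, radiusPdf n σ r

/-- The sphere bound of Kasami et al.: on each sphere about the transmitted vector, the
conditional error probability is bounded by the smaller of the conditional union bound and `1`,
and the result is averaged over the radius. -/
def kasamiBound {n : ℕ} (C : Submodule (ZMod 2) (Fin n → ZMod 2)) (σ : ℝ) : ℝ :=
  ∫ r in Set.Ioi (0 : ℝ), min (unionBound C r) 1 * radiusPdf n σ r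

/-- The density of the squared noise norm `Y`, at `y > 0`. -/
def sqNormPdf (n : ℕ) (σ y : ℝ) : ℝ :=
  y ^ ((n : ℝ) / 2 - 1) * Real.exp (-y / (2 * σ ^ 2)) /
    ((2 : ℝ) ^ ((n : ℝ) / 2) * σ ^ n * Real.Gamma ((n : ℝ) / 2))

/-- The joint density of `Z₁`, the noise component along a fixed direction, and of the squared
noise norm `Y`, at a point with `z ^ 2 < y`. -/
def jointPdf (n : ℕ) (σ z y : ℝ) : ℝ :=
  (y - z ^ 2) ^ (((n : ℝ) - 3) / 2) * Real.exp (-y / (2 * σ ^ 2)) /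
    (Real.sqrt Real.pi * (2 : ℝ) ^ ((n : ℝ) / 2) * σ ^ n * Real.Gamma (((n : ℝ) - 1) / 2))

/-- The sphere bound of Herzberg and Poltyrev with radius `ρ`:
`∑_d A_d Pr{Z₁ ≥ √d, Y ≤ ρ²} + Pr{Y > ρ²}`, the sum being over the `d` with `√d < ρ`. -/
def herzbergPoltyrevBound {n : ℕ} (C : Submodule (ZMod 2) (Fin n → ZMod 2)) (σ ρ : ℝ) : ℝ :=
  (∑ d ∈ (Finset.Icc 1 n).filter (fun d : ℕ => Real.sqrt d < ρ), (weightDist C d : ℝ) *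
      ∫ z in Real.sqrt d..ρ, ∫ y in (z ^ 2)..(ρ ^ 2), jointPdf n σ z y) +
    ∫ y in Set.Ioi (ρ ^ 2), sqNormPdf n σ y

/-- The equation of Herzberg and Poltyrev for the optimal radius. -/
def HerzbergPoltyrevRadius {n : ℕ} (C : Submodule (ZMod 2) (Fin n → ZMod 2)) (r : ℝ) : Prop :=
  ∑ d ∈ (Finset.Icc 1 n).filter (fun d : ℕ => Real.sqrt d < r), (weightDist C d : ℝ) *
      (∫ φ in (0 : ℝ)..Real.arccos (Real.sqrt d / r), Real.sin φ ^ (n - 2)) =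
    Real.sqrt Real.pi * Real.Gamma (((n : ℝ) - 1) / 2) / Real.Gamma ((n : ℝ) / 2)

end SphereBound

end

/-!
The argument rests on two facts.

First, `f_u` is a finite sum, over the nonzero codewords, of the functions `capFraction n a` with
`a = √d`: the fraction of a sphere of radius `r` that lies in a cap at distance `a` from the centre.
Each of these is `0` up to `r = a`, strictly increases after that, and tends to `1 / 2`. A code of
dimension at least `2` has three or more nonzero codewords, so that `f_u` is continuous, starts
at `0`, has a limit above `1`, and crosses `1` exactly once (`exists_unique_radius`). Being
monotone, `f_u` is below `1` before the crossing `r₁` and above it afterwards, whence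
`∫ min(f_u, 1) g = ∫₀^{r₁} f_u g + ∫_{r₁}^∞ g`, while for any other radius the right-hand side is at
least the left-hand side (`kasamiBound_eq_sphereBound`, `kasamiBound_le_sphereBound`).

Second, the probability that the noise lies in the cap region `{⟪u, x⟫ ≥ a, ‖x‖ < ρ}` is an integral
over the half-plane whose coordinates are the component `z = ⟪u, x⟫` and the norm `s` of the
orthogonal component (`capMass`, `noise_cap`). Polar coordinates in this half-plane turn it into
`∫₀^ρ capFraction · g` (`capMass_eq_lintegral`), a term of the sphere bound. The substitution
`y = z² + s²` turns it into the double integral of Herzberg and Poltyrev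
(`integral_integral_jointPdf`). A decoding error with noise of norm below `ρ` puts the noise into
the cap region of one of the other codewords, so a union bound gives the bound on the error
probability (`noise_error_le`).

By linearity, the distances from any codeword to the others are the numbers `2√d` with `d` running
through the nonzero weights (`sum_dist_bpskCode`). This reduces averages over the codewords and sums
over pairs to the weight distribution.
-/

namespace SphereBound

open Set Module
open scoped ENNReal RealInnerProductSpace

/-! ### Spherical caps and the radius equation -/

/-- The reciprocal of `∫₀^π sin^(n-2)`, in terms of Gamma functions. -/
noncomputable def capConst (n : ℕ) : ℝ :=
  Real.Gamma ((n : ℝ) / 2) / (√Real.pi * Real.Gamma (((n : ℝ) - 1) / 2))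

/-- The fraction of a sphere of radius `r` in `ℝⁿ` that is covered by the cap at distance `a` from
the centre. -/
noncomputable def capFraction (n : ℕ) (a r : ℝ) : ℝ :=
  if a < r then capConst n * ∫ φ in (0 : ℝ)..Real.arccos (a / r), Real.sin φ ^ (n - 2) else 0

theorem p₂_eq_capFraction (n : ℕ) (r : ℝ) (d : ℕ) : p₂ n r d = capFraction n √d r := rfl

theorem pairwise_eq_capFraction (n : ℕ) (r δ : ℝ) : pairwise n r δ = capFraction n (δ / 2) r := by
  simp [pairwise, capFraction, capConst, div_div]

theorem Gamma_half_pos {n : ℕ} (hn : 0 < n) : 0 < Real.Gamma ((n : ℝ) / 2) :=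
  Real.Gamma_pos_of_pos (by positivity)

theorem Gamma_pred_half_pos {n : ℕ} (hn : 2 ≤ n) : 0 < Real.Gamma (((n : ℝ) - 1) / 2) := by
  have : (2 : ℝ) ≤ n := by exact_mod_cast hn
  exact Real.Gamma_pos_of_pos (by linarith)

theorem capConst_pos {n : ℕ} (hn : 2 ≤ n) : 0 < capConst n :=
  div_pos (Gamma_half_pos (by omega))
    (mul_pos (Real.sqrt_pos.2 Real.pi_pos) (Gamma_pred_half_pos hn))

/-- A half-sphere is half of the sphere. -/
theorem capConst_mul_integral_half (k : ℕ) :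
    capConst (k + 2) * ∫ φ in (0 : ℝ)..Real.pi / 2, Real.sin φ ^ k = 1 / 2 := by
  have hpi : 0 < √Real.pi := Real.sqrt_pos.2 Real.pi_pos
  induction k using Nat.twoStepInduction with
  | zero =>
    have h : (((0 + 2 : ℕ) : ℝ) - 1) / 2 = 1 / 2 := by norm_num
    rw [capConst, h, Real.Gamma_one_half_eq, Real.mul_self_sqrt Real.pi_pos.le]
    norm_num [Real.Gamma_one]
    field_simp
  | one =>
    have h : ((1 + 2 : ℕ) : ℝ) / 2 = 1 / 2 + 1 := by norm_num
    have h' : (((1 + 2 : ℕ) : ℝ) - 1) / 2 = 1 := by norm_num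
    rw [capConst, h, h', Real.Gamma_add_one (by norm_num), Real.Gamma_one_half_eq, Real.Gamma_one]
    simp only [pow_one, integral_sin, Real.cos_zero, Real.cos_pi_div_two]
    field_simp
    norm_num
  | more k ih _ =>
    have hk : (0 : ℝ) ≤ k := Nat.cast_nonneg k
    have h : ((k + 2 + 2 : ℕ) : ℝ) / 2 = ((k + 2 : ℕ) : ℝ) / 2 + 1 := by push_cast; ring
    have h' : (((k + 2 + 2 : ℕ) : ℝ) - 1) / 2 = (((k + 2 : ℕ) : ℝ) - 1) / 2 + 1 := by
      push_cast; ring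
    have hpos : (0 : ℝ) < (((k + 2 : ℕ) : ℝ) - 1) / 2 := by push_cast; linarith
    have hG := Gamma_pred_half_pos (n := k + 2) (by omega)
    rw [capConst] at ih ⊢
    rw [h, h', Real.Gamma_add_one (by positivity), Real.Gamma_add_one hpos.ne', integral_sin_pow]
    rw [← ih]
    have e : (((k + 2 : ℕ) : ℝ) - 1) / 2 = ((k : ℝ) + 1) / 2 := by push_cast; ring
    simp only [Real.sin_zero, Real.cos_zero, Real.sin_pi_div_two, Real.cos_pi_div_two]
    rw [e] at hG ⊢
    push_cast
    field_simp
    simp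

theorem continuous_integral_sin_pow (k : ℕ) :
    Continuous fun θ => ∫ φ in (0 : ℝ)..θ, Real.sin φ ^ k :=
  intervalIntegral.continuous_primitive
    (fun _ _ => (Real.continuous_sin.pow k).intervalIntegrable _ _) 0

theorem strictMonoOn_integral_sin_pow (k : ℕ) :
    StrictMonoOn (fun θ => ∫ φ in (0 : ℝ)..θ, Real.sin φ ^ k) (Icc 0 Real.pi) := by
  intro x hx y hy hxy
  have hi : ∀ a b : ℝ, IntervalIntegrable (fun φ => Real.sin φ ^ k) volume a b := fun _ _ =>
    (Real.continuous_sin.pow k).intervalIntegrable _ _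
  have h := intervalIntegral.integral_add_adjacent_intervals (hi 0 x) (hi x y)
  have hpos : 0 < ∫ φ in x..y, Real.sin φ ^ k :=
    intervalIntegral.intervalIntegral_pos_of_pos_on (hi x y)
      (fun φ hφ => pow_pos (Real.sin_pos_of_mem_Ioo
        ⟨hx.1.trans_lt hφ.1, hφ.2.trans_le hy.2⟩) k) hxy
  change (∫ φ in (0 : ℝ)..x, Real.sin φ ^ k) < ∫ φ in (0 : ℝ)..y, Real.sin φ ^ k
  linarith

/-- For `a > 0` the case distinction in `capFraction` is harmless: both cases are instances of one
continuous expression. -/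
theorem capFraction_eq_max (n : ℕ) {a : ℝ} (ha : 0 < a) (r : ℝ) :
    capFraction n a r =
      capConst n * ∫ φ in (0 : ℝ)..Real.arccos (a / max a r), Real.sin φ ^ (n - 2) := by
  unfold capFraction
  split_ifs with h
  · rw [max_eq_right h.le]
  · rw [max_eq_left (not_lt.1 h), div_self ha.ne', Real.arccos_one, intervalIntegral.integral_same,
      mul_zero]

theorem continuous_capFraction (n : ℕ) {a : ℝ} (ha : 0 < a) : Continuous (capFraction n a) := by
  simp_rw [funext (capFraction_eq_max n ha)]
  refine continuous_const.mul ((continuous_integral_sin_pow _).comp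
    (Real.continuous_arccos.comp (continuous_const.div (by fun_prop) fun r => ?_)))
  exact (lt_max_of_lt_left ha).ne'

theorem capFraction_of_le (n : ℕ) {a r : ℝ} (h : r ≤ a) : capFraction n a r = 0 :=
  if_neg (not_lt.2 h)

theorem strictMonoOn_capFraction {n : ℕ} (hn : 2 ≤ n) {a : ℝ} (ha : 0 < a) :
    StrictMonoOn (capFraction n a) (Ici a) := by
  intro r hr s hs hrs
  have hr : a ≤ r := hr
  have hr0 : 0 < r := ha.trans_le hr
  have hs0 : 0 < s := hr0.trans hrs
  rw [capFraction_eq_max n ha, capFraction_eq_max n ha, max_eq_right hr,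
    max_eq_right (hr.trans hrs.le)]
  refine mul_lt_mul_of_pos_left (strictMonoOn_integral_sin_pow _
    ⟨Real.arccos_nonneg _, Real.arccos_le_pi _⟩ ⟨Real.arccos_nonneg _, Real.arccos_le_pi _⟩ ?_)
    (capConst_pos hn)
  have h0 : 0 < a / s := by positivity
  have h1 : a / r ≤ 1 := (div_le_one hr0).2 hr
  have h2 : a / s < a / r := div_lt_div_of_pos_left ha hr0 hrs
  exact Real.strictAntiOn_arccos ⟨by linarith, by linarith⟩ ⟨by linarith, h1⟩ h2

theorem monotone_capFraction {n : ℕ} (hn : 2 ≤ n) {a : ℝ} (ha : 0 < a) :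
    Monotone (capFraction n a) := by
  intro r s hrs
  rcases le_or_gt r a with h | h
  · rw [capFraction_of_le n h]
    rcases le_or_gt s a with h' | h'
    · rw [capFraction_of_le n h']
    · rw [← capFraction_of_le n (le_refl a)]
      exact (strictMonoOn_capFraction hn ha).monotoneOn self_mem_Ici h'.le h'.le
  · exact (strictMonoOn_capFraction hn ha).monotoneOn h.le (h.le.trans hrs) hrs

theorem capFraction_nonneg {n : ℕ} (hn : 2 ≤ n) {a : ℝ} (ha : 0 < a) (r : ℝ) :
    0 ≤ capFraction n a r := by
  rcases le_or_gt r a with h | h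
  · rw [capFraction_of_le n h]
  · rw [← capFraction_of_le n (le_refl a)]
    exact monotone_capFraction hn ha h.le

theorem tendsto_capFraction {n : ℕ} (hn : 2 ≤ n) {a : ℝ} (ha : 0 < a) :
    Filter.Tendsto (capFraction n a) Filter.atTop (nhds (1 / 2)) := by
  obtain ⟨k, rfl⟩ : ∃ k, n = k + 2 := ⟨n - 2, by omega⟩
  have h0 : Filter.Tendsto (fun r : ℝ => a / max a r) Filter.atTop (nhds 0) :=
    Filter.Tendsto.div_atTop tendsto_const_nhds
      (Filter.tendsto_atTop_mono (fun r => le_max_right a r) Filter.tendsto_id)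
  have h1 := ((continuous_integral_sin_pow k).comp Real.continuous_arccos).tendsto 0
  rw [Function.comp_apply, Real.arccos_zero] at h1
  rw [← capConst_mul_integral_half k]
  refine Filter.Tendsto.congr (fun r => (capFraction_eq_max (k + 2) ha r).symm) ?_
  exact (h1.comp h0).const_mul _

/-- The radius equation has a unique solution as soon as there are three competitors: each of the
summands tends to `1 / 2`, and is strictly increasing where it is not `0`. -/
theorem exists_unique_radius {n : ℕ} (hn : 2 ≤ n) {ι : Type*} (s : Finset ι) (a : ι → ℝ)
    (ha : ∀ i ∈ s, 0 < a i) (hs : 3 ≤ s.card) :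
    ∃ r₁ : ℝ, 0 < r₁ ∧ ∀ r : ℝ, ∑ i ∈ s, capFraction n (a i) r = 1 ↔ r = r₁ := by
  set U : ℝ → ℝ := fun r => ∑ i ∈ s, capFraction n (a i) r with hU
  have hmono : Monotone U := fun x y hxy =>
    Finset.sum_le_sum fun i hi => monotone_capFraction hn (ha i hi) hxy
  have hcont : Continuous U := continuous_finsetSum _ fun i hi => continuous_capFraction n (ha i hi)
  have hlim : Filter.Tendsto U Filter.atTop (nhds (∑ _i ∈ s, 1 / 2)) :=
    tendsto_finsetSum _ fun i hi => tendsto_capFraction hn (ha i hi)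
  have h1 : (1 : ℝ) < ∑ _i ∈ s, 1 / 2 := by
    have : (3 : ℝ) ≤ s.card := by exact_mod_cast hs
    rw [Finset.sum_const, nsmul_eq_mul]
    linarith
  have hneg : ∀ r ≤ 0, U r = 0 := fun r hr =>
    Finset.sum_eq_zero fun i hi => capFraction_of_le n (hr.trans (ha i hi).le)
  obtain ⟨R, hR, hR0⟩ := ((hlim.eventually (lt_mem_nhds h1)).and
    (Filter.eventually_ge_atTop 0)).exists
  obtain ⟨r₁, hr₁, hr₁'⟩ := intermediate_value_Icc hR0 hcont.continuousOn
    (show (1 : ℝ) ∈ Icc (U 0) (U R) from ⟨by rw [hneg 0 le_rfl]; norm_num, hR.le⟩)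
  have hpos : ∀ r, U r = 1 → 0 < r := fun r hr => by
    by_contra hc
    rw [hneg r (not_lt.1 hc)] at hr
    norm_num at hr
  -- where `U = 1`, some summand is nonzero, so it is strictly increasing from there on
  have hstrict : ∀ r t, U r = 1 → r < t → U r < U t := by
    intro r t hr hrt
    obtain ⟨i, hi, hi0⟩ : ∃ i ∈ s, capFraction n (a i) r ≠ 0 :=
      Finset.exists_ne_zero_of_sum_ne_zero (by rw [show ∑ i ∈ s, _ = U r from rfl, hr]; norm_num)
    have hri : a i < r := by
      by_contra hc
      exact hi0 (capFraction_of_le n (not_lt.1 hc))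
    exact Finset.sum_lt_sum (fun j hj => monotone_capFraction hn (ha j hj) hrt.le)
      ⟨i, hi, strictMonoOn_capFraction hn (ha i hi) hri.le (hri.le.trans hrt.le) hrt⟩
  refine ⟨r₁, hpos r₁ hr₁', fun r => ⟨fun hr => ?_, fun h => h ▸ hr₁'⟩⟩
  have hr : U r = 1 := hr
  rcases lt_trichotomy r r₁ with h | h | h
  · have := hstrict r r₁ hr h
    linarith
  · exact h
  · have := hstrict r₁ r hr₁' h
    linarith

/-! ### Integration of functions of a component and the norm -/

/-- Fubini's theorem in `n` variables, for a product of functions in `ℝ≥0∞`. -/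
theorem lintegral_fin_prod_eq_prod {n : ℕ} {α : Type*} [MeasurableSpace α] (μ : Measure α)
    [SigmaFinite μ] (f : Fin n → α → ℝ≥0∞) (hf : ∀ i, Measurable (f i)) :
    ∫⁻ x : Fin n → α, ∏ i, f i (x i) ∂(Measure.pi fun _ => μ) = ∏ i, ∫⁻ x, f i x ∂μ := by
  induction n with
  | zero => simp
  | succ n ih =>
    rw [← ((measurePreserving_piFinSuccAbove (fun _ => μ) (0 : Fin (n + 1))).symm).lintegral_comp
      (f := fun x => ∏ i, f i (x i))
      (Finset.measurable_prod _ fun i _ => (hf i).comp (measurable_pi_apply i))]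
    simp_rw [MeasurableEquiv.piFinSuccAbove_symm_apply, Fin.insertNthEquiv,
      Fin.prod_univ_succ, Fin.insertNth_zero, Equiv.coe_fn_mk, Fin.cons_succ,
      Fin.cons_zero]
    rw [← ih (fun i => f i.succ) fun i => hf _, ← lintegral_prod_mul (hf 0).aemeasurable]
    · rfl
    · exact (Finset.measurable_prod _ fun i _ =>
        (hf i.succ).comp (measurable_pi_apply i)).aemeasurable

theorem pi_withDensity {n : ℕ} {α : Type*} [MeasurableSpace α] (μ : Measure α)
    [SigmaFinite μ] {p : α → ℝ≥0∞} (hp : Measurable p) [SigmaFinite (μ.withDensity p)] :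
    (Measure.pi fun _ : Fin n => μ.withDensity p) =
      (Measure.pi fun _ : Fin n => μ).withDensity fun x => ∏ i, p (x i) := by
  refine Measure.pi_eq fun s hs => ?_
  rw [withDensity_apply _ (MeasurableSet.univ_pi hs),
    ← lintegral_indicator (MeasurableSet.univ_pi hs)]
  have h : ∀ x : Fin n → α, (univ.pi s).indicator (fun x => ∏ i, p (x i)) x =
      ∏ i, (s i).indicator p (x i) := by
    intro x
    by_cases hx : x ∈ univ.pi s
    · rw [indicator_of_mem hx]
      exact Finset.prod_congr rfl fun i _ => (indicator_of_mem (hx i trivial) _).symm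
    · rw [indicator_of_notMem hx]
      obtain ⟨i, hi⟩ : ∃ i, x i ∉ s i := by simpa [Set.mem_pi] using hx
      exact (Finset.prod_eq_zero (Finset.mem_univ i) (indicator_of_notMem hi _)).symm
  simp_rw [h]
  rw [lintegral_fin_prod_eq_prod μ (fun i => (s i).indicator p) fun i => hp.indicator (hs i)]
  refine Finset.prod_congr rfl fun i _ => ?_
  rw [lintegral_indicator (hs i), withDensity_apply _ (hs i)]

/-- Integration of a radial function in `ℝ≥0∞` in spherical coordinates. -/
theorem lintegral_fun_norm {E : Type*} [NormedAddCommGroup E] [NormedSpace ℝ E]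
    [MeasurableSpace E] [Nontrivial E] [FiniteDimensional ℝ E] [BorelSpace E]
    (μ : Measure E) [μ.IsAddHaarMeasure] {f : ℝ → ℝ≥0∞} (hf : Measurable f) :
    ∫⁻ x, f ‖x‖ ∂μ = finrank ℝ E * μ (Metric.ball 0 1) *
      ∫⁻ y in Ioi (0 : ℝ), ENNReal.ofReal (y ^ (finrank ℝ E - 1)) * f y :=
  calc
    ∫⁻ x, f ‖x‖ ∂μ = ∫⁻ x : ({(0)}ᶜ : Set E), f ‖x.1‖ ∂(μ.comap (↑)) := by
      rw [lintegral_subtype_comap (measurableSet_singleton _).compl fun x => f ‖x‖,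
        restrict_compl_singleton]
    _ = ∫⁻ x, f x.2 ∂μ.toSphere.prod (.volumeIoiPow (finrank ℝ E - 1)) := by
      simpa using μ.measurePreserving_homeomorphUnitSphereProd.lintegral_comp_emb
        (Homeomorph.measurableEmbedding _) (f ∘ Subtype.val ∘ Prod.snd)
    _ = μ.toSphere univ * ∫⁻ x : Ioi (0 : ℝ), f x ∂.volumeIoiPow (finrank ℝ E - 1) := by
      rw [lintegral_prod _ (by fun_prop)]
      simp [mul_comm]
    _ = _ := by
      rw [μ.toSphere_apply_univ, Measure.volumeIoiPow, lintegral_withDensity_eq_lintegral_mul]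
      · congr 1
        exact lintegral_subtype_comap measurableSet_Ioi
          fun a : ℝ => ENNReal.ofReal (a ^ (finrank ℝ E - 1)) * f a
      · fun_prop
      · fun_prop

/-- The surface area of the unit sphere of `ℝᵐ`. -/
theorem finrank_mul_volume_ball (m : ℕ) (hm : 0 < m) :
    (m : ℝ≥0∞) * volume (Metric.ball (0 : EuclideanSpace ℝ (Fin m)) 1) =
      ENNReal.ofReal (2 * √Real.pi ^ m / Real.Gamma ((m : ℝ) / 2)) := by
  have : Nonempty (Fin m) := ⟨⟨0, hm⟩⟩
  have hm' : (0 : ℝ) < m := by exact_mod_cast hm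
  have hG : 0 < Real.Gamma ((m : ℝ) / 2) := Real.Gamma_pos_of_pos (by positivity)
  rw [EuclideanSpace.volume_ball, Fintype.card_fin, Real.Gamma_add_one (by positivity),
    ← ENNReal.ofReal_natCast m, ENNReal.ofReal_one, one_pow, one_mul,
    ← ENNReal.ofReal_mul (by positivity)]
  congr 1
  field_simp

/-- Polar coordinates `z = r cos φ`, `s = r sin φ` in the half-plane `s > 0`, for the weight `s ^ k`
that comes from the orthogonal directions. -/
theorem lintegral_halfPlane_polar (k : ℕ) (F : ℝ → ℝ → ℝ≥0∞)
    (hF : Measurable (Function.uncurry F)) :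
    ∫⁻ z : ℝ, ∫⁻ s in Ioi (0 : ℝ), ENNReal.ofReal (s ^ k) * F z √(z ^ 2 + s ^ 2) =
      ∫⁻ r in Ioi (0 : ℝ), ∫⁻ φ in Ioo 0 Real.pi,
        ENNReal.ofReal (r ^ (k + 1) * Real.sin φ ^ k) * F (r * Real.cos φ) r := by
  set G : ℝ × ℝ → ℝ≥0∞ := fun p =>
    (Ioi (0 : ℝ)).indicator (fun s => ENNReal.ofReal (s ^ k) * F p.1 √(p.1 ^ 2 + s ^ 2)) p.2
    with hG
  have hFm : ∀ {α : Type} [MeasurableSpace α] {f g : α → ℝ}, Measurable f → Measurable g →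
      Measurable fun x => F (f x) (g x) := fun hf hg => hF.comp (hf.prodMk hg)
  have hGm : Measurable G := by
    have : G = (Prod.snd ⁻¹' Ioi (0 : ℝ)).indicator
        fun p : ℝ × ℝ => ENNReal.ofReal (p.2 ^ k) * F p.1 √(p.1 ^ 2 + p.2 ^ 2) := by
      ext p; simp [hG, indicator]
    rw [this]
    refine Measurable.indicator ?_ (measurable_snd measurableSet_Ioi)
    exact (by fun_prop : Measurable fun p : ℝ × ℝ => ENNReal.ofReal (p.2 ^ k)).mul
      (hFm (by fun_prop) (by fun_prop))
  have h1 : ∫⁻ z : ℝ, ∫⁻ s in Ioi (0 : ℝ), ENNReal.ofReal (s ^ k) * F z √(z ^ 2 + s ^ 2) =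
      ∫⁻ p, G p := by
    rw [Measure.volume_eq_prod, lintegral_prod _ hGm.aemeasurable]
    exact lintegral_congr fun z => (lintegral_indicator measurableSet_Ioi _).symm
  rw [h1, ← lintegral_comp_polarCoord_symm, polarCoord_target, Measure.volume_eq_prod,
    setLIntegral_prod]
  · refine setLIntegral_congr_fun measurableSet_Ioi fun r hr => ?_
    have hr : 0 < r := hr
    rw [← lintegral_indicator measurableSet_Ioo, ← lintegral_indicator measurableSet_Ioo]
    refine lintegral_congr fun φ => ?_
    simp only [polarCoord_symm_apply, hG]
    by_cases h : φ ∈ Ioo 0 Real.pi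
    · have hs := Real.sin_pos_of_mem_Ioo h
      have h2 : φ ∈ Ioo (-Real.pi) Real.pi := ⟨by linarith [h.1, Real.pi_pos], h.2⟩
      have hsq : √((r * Real.cos φ) ^ 2 + (r * Real.sin φ) ^ 2) = r := by
        rw [show (r * Real.cos φ) ^ 2 + (r * Real.sin φ) ^ 2
          = r ^ 2 * (Real.sin φ ^ 2 + Real.cos φ ^ 2) by ring, Real.sin_sq_add_cos_sq, mul_one,
          Real.sqrt_sq hr.le]
      rw [indicator_of_mem h2, indicator_of_mem h,
        indicator_of_mem (show r * Real.sin φ ∈ Ioi (0 : ℝ) from mul_pos hr hs), hsq,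
        smul_eq_mul, ← mul_assoc, ← ENNReal.ofReal_mul hr.le]
      congr 2
      ring
    -- the angles in `(-π, 0]` belong to the half-plane `s ≤ 0`, where the integrand vanishes
    · rw [indicator_of_notMem h]
      by_cases h2 : φ ∈ Ioo (-Real.pi) Real.pi
      · have hφ : φ ≤ 0 := by
          by_contra hc
          exact h ⟨not_le.1 hc, h2.2⟩
        have hs : Real.sin φ ≤ 0 := Real.sin_nonpos_of_nonpos_of_neg_pi_le hφ h2.1.le
        rw [indicator_of_mem h2, indicator_of_notMem, smul_zero]
        exact not_lt.2 (mul_nonpos_of_nonneg_of_nonpos hr.le hs)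
      · rw [indicator_of_notMem h2]
  · refine Measurable.aemeasurable ?_
    have h3 : Measurable fun p : ℝ × ℝ => polarCoord.symm p := by
      simp only [polarCoord_symm_apply]
      fun_prop
    exact (ENNReal.measurable_ofReal.comp measurable_fst).smul (hGm.comp h3)

/-- A function of the component along `u` and of the norm can be integrated over the half-plane of
the component `z` along `u` and the norm `s` of the orthogonal component. -/
theorem lintegral_inner_norm (m : ℕ) (hm : 0 < m) (u : EuclideanSpace ℝ (Fin (m + 1)))
    (hu : ‖u‖ = 1) (F : ℝ → ℝ → ℝ≥0∞) (hF : Measurable (Function.uncurry F)) :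
    ∫⁻ x, F ⟪u, x⟫ ‖x‖ = ENNReal.ofReal (2 * √Real.pi ^ m / Real.Gamma ((m : ℝ) / 2)) *
      ∫⁻ z : ℝ, ∫⁻ s in Ioi (0 : ℝ), ENNReal.ofReal (s ^ (m - 1)) * F z √(z ^ 2 + s ^ 2) := by
  have hFm : ∀ {α : Type} [MeasurableSpace α] {f g : α → ℝ}, Measurable f → Measurable g →
      Measurable fun x => F (f x) (g x) := fun hf hg => hF.comp (hf.prodMk hg)
  set e : EuclideanSpace ℝ (Fin (m + 1)) := EuclideanSpace.single 0 1 with he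
  have hne : ‖u‖ = ‖e‖ := by simp [he, hu]
  -- a reflection takes `u` to the first basis vector
  set L := (ℝ ∙ (u - e))ᗮ.reflection with hL
  have hLu : L u = e := Submodule.reflection_sub hne
  have h1 : ∫⁻ x, F ⟪u, x⟫ ‖x‖ = ∫⁻ x : EuclideanSpace ℝ (Fin (m + 1)), F (x 0) ‖x‖ := by
    rw [← L.measurePreserving.lintegral_comp (f := fun x => F (x 0) ‖x‖)
      (hFm (by fun_prop) (by fun_prop))]
    refine lintegral_congr fun x => ?_
    rw [← L.inner_map_map u x, hLu, LinearIsometryEquiv.norm_map, he,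
      EuclideanSpace.inner_single_left]
    simp
  have : Nonempty (Fin m) := ⟨⟨0, hm⟩⟩
  rw [h1, ← (PiLp.volume_preserving_toLp (Fin (m + 1))).lintegral_comp
      (f := fun x : EuclideanSpace ℝ (Fin (m + 1)) => F (x 0) ‖x‖)
      (hFm (by fun_prop) (by fun_prop)),
    ← ((volume_preserving_piFinSuccAbove (fun _ => ℝ) (0 : Fin (m + 1))).symm).lintegral_comp
      (hFm (by fun_prop) (by fun_prop)), Measure.volume_eq_prod, lintegral_prod]
  · rw [← lintegral_const_mul']
    · refine lintegral_congr fun z => ?_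
      have hmeas : Measurable fun s => F z √(z ^ 2 + s ^ 2) := hFm (by fun_prop) (by fun_prop)
      have key := lintegral_fun_norm (volume : Measure (EuclideanSpace ℝ (Fin m))) hmeas
      rw [finrank_euclideanSpace_fin, finrank_mul_volume_ball m hm,
        ← (PiLp.volume_preserving_toLp (Fin m)).lintegral_comp
          (f := fun x : EuclideanSpace ℝ (Fin m) => F z √(z ^ 2 + ‖x‖ ^ 2))
          (hFm (by fun_prop) (by fun_prop))] at key
      rw [← key]
      refine lintegral_congr fun w => ?_
      congr 1
      rw [EuclideanSpace.norm_eq, EuclideanSpace.norm_sq_eq, Fin.sum_univ_succ]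
      simp [MeasurableEquiv.piFinSuccAbove_symm_apply, Fin.insertNthEquiv]
    · exact ENNReal.ofReal_ne_top
  · refine Measurable.aemeasurable ?_
    exact hFm (by fun_prop) (by fun_prop)

/-! ### The probability of a cap region -/

theorem radiusPdf_nonneg {n : ℕ} (hn : 0 < n) {σ : ℝ} (hσ : 0 < σ) {r : ℝ} (hr : 0 ≤ r) :
    0 ≤ radiusPdf n σ r := by
  have := Gamma_half_pos hn
  unfold radiusPdf
  positivity

theorem continuous_radiusPdf (n : ℕ) (σ : ℝ) : Continuous (radiusPdf n σ) := by
  unfold radiusPdf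
  fun_prop

theorem integrable_radiusPdf (n : ℕ) {σ : ℝ} (hσ : 0 < σ) : Integrable (radiusPdf n σ) := by
  have h := integrable_rpow_mul_exp_neg_mul_sq (b := 1 / (2 * σ ^ 2)) (by positivity)
    (s := ((n - 1 : ℕ) : ℝ)) (by linarith [Nat.cast_nonneg (α := ℝ) (n - 1)])
  refine (h.const_mul (2 / ((2 : ℝ) ^ ((n : ℝ) / 2) * σ ^ n * Real.Gamma ((n : ℝ) / 2)))).congr
    (Filter.Eventually.of_forall fun r => ?_)
  simp only [radiusPdf, Real.rpow_natCast]
  rw [show -(1 / (2 * σ ^ 2)) * r ^ 2 = -r ^ 2 / (2 * σ ^ 2) by ring]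
  ring

/-- The value at the origin of the density of the noise vector. -/
noncomputable def noiseConst (n : ℕ) (σ : ℝ) : ℝ := (√(2 * Real.pi * σ ^ 2))⁻¹ ^ n

theorem noise_eq_withDensity (n : ℕ) {σ : ℝ} (hσ : 0 < σ) :
    noise n σ = (volume : Measure (EuclideanSpace ℝ (Fin n))).withDensity
      fun x => ENNReal.ofReal (noiseConst n σ * Real.exp (-‖x‖ ^ 2 / (2 * σ ^ 2))) := by
  have hv : Real.toNNReal (σ ^ 2) ≠ 0 := by simpa using hσ.ne'
  have hg : gaussianReal 0 (Real.toNNReal (σ ^ 2)) =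
      volume.withDensity (gaussianPDF 0 (Real.toNNReal (σ ^ 2))) := gaussianReal_of_var_ne_zero _ hv
  have : SigmaFinite ((volume : Measure ℝ).withDensity
      (gaussianPDF 0 (Real.toNNReal (σ ^ 2)))) := by rw [← hg]; infer_instance
  unfold noise
  simp_rw [hg]
  rw [pi_withDensity volume (measurable_gaussianPDF _ _)]
  refine Measure.ext fun s hs => ?_
  have hm : Measurable (WithLp.toLp 2 : (Fin n → ℝ) → EuclideanSpace ℝ (Fin n)) := by fun_prop
  rw [Measure.map_apply hm hs, withDensity_apply _ (hm hs), withDensity_apply _ hs,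
    ← (PiLp.volume_preserving_toLp (Fin n)).setLIntegral_comp_preimage hs (by fun_prop)]
  refine setLIntegral_congr_fun (hm hs) fun x _ => ?_
  simp only [gaussianPDF]
  rw [← ENNReal.ofReal_prod_of_nonneg fun i _ => gaussianPDFReal_nonneg _ _ _]
  congr 1
  simp only [gaussianPDFReal, Finset.prod_mul_distrib, Finset.prod_const, Finset.card_univ,
    Fintype.card_fin, ← Real.exp_sum, sub_zero, Real.coe_toNNReal _ (sq_nonneg σ), noiseConst]
  rw [← Finset.sum_div, Finset.sum_neg_distrib, EuclideanSpace.norm_sq_eq]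
  simp

/-- The constant in the density of the pair formed by the noise component along a fixed direction
and the norm of the orthogonal component. -/
noncomputable def axialConst (n : ℕ) (σ : ℝ) : ℝ :=
  2 / (√Real.pi * (2 : ℝ) ^ ((n : ℝ) / 2) * σ ^ n * Real.Gamma (((n : ℝ) - 1) / 2))

theorem axialConst_nonneg {n : ℕ} (hn : 2 ≤ n) {σ : ℝ} (hσ : 0 < σ) : 0 ≤ axialConst n σ := by
  have := Gamma_pred_half_pos hn
  unfold axialConst
  positivity

theorem noiseConst_eq (n : ℕ) {σ : ℝ} (hσ : 0 < σ) :
    noiseConst n σ = 1 / (√Real.pi ^ n * (2 : ℝ) ^ ((n : ℝ) / 2) * σ ^ n) := by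
  rw [noiseConst, Real.rpow_div_two_eq_sqrt _ zero_le_two, Real.rpow_natCast,
    Real.sqrt_mul (by positivity), Real.sqrt_mul zero_le_two, Real.sqrt_sq hσ.le, inv_pow,
    mul_pow, mul_pow, one_div, mul_comm (√2 ^ n)]

theorem noiseConst_mul_axial (m : ℕ) {σ : ℝ} (hσ : 0 < σ) :
    2 * √Real.pi ^ m / Real.Gamma ((m : ℝ) / 2) * noiseConst (m + 1) σ = axialConst (m + 1) σ := by
  have hpi : 0 < √Real.pi := Real.sqrt_pos.2 Real.pi_pos
  rw [noiseConst_eq _ hσ, axialConst, pow_succ √Real.pi]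
  simp only [Nat.cast_add, Nat.cast_one, add_sub_cancel_right]
  field_simp

/-- The normalizations agree: integrating the axial density over the angles of a cap gives the
fraction of the sphere in the cap, times the density of the radius. -/
theorem axialConst_mul_capFraction {n : ℕ} (hn : 2 ≤ n) {σ : ℝ} (hσ : 0 < σ) (r I : ℝ) :
    r ^ (n - 1) * (axialConst n σ * Real.exp (-r ^ 2 / (2 * σ ^ 2))) * I =
      capConst n * I * radiusPdf n σ r := by
  have hpi : 0 < √Real.pi := Real.sqrt_pos.2 Real.pi_pos
  have h1 := Gamma_half_pos (n := n) (by omega)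
  have h2 := Gamma_pred_half_pos hn
  rw [axialConst, capConst, radiusPdf]
  field_simp

/-- The density in the half-plane of the noise, in terms of the component `z` along a fixed
direction and of the norm `r`, cut off to the cap region `a ≤ z`, `r < ρ`. -/
noncomputable def capDensity (n : ℕ) (σ a ρ z r : ℝ) : ℝ≥0∞ :=
  {p : ℝ × ℝ | a ≤ p.1 ∧ p.2 < ρ}.indicator
    (fun p => ENNReal.ofReal (axialConst n σ * Real.exp (-p.2 ^ 2 / (2 * σ ^ 2)))) (z, r)

theorem measurableSet_cap (a ρ : ℝ) : MeasurableSet {p : ℝ × ℝ | a ≤ p.1 ∧ p.2 < ρ} :=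
  (measurableSet_le measurable_const measurable_fst).inter
    (measurableSet_lt measurable_snd measurable_const)

theorem measurable_capDensity (n : ℕ) (σ a ρ : ℝ) :
    Measurable (Function.uncurry (capDensity n σ a ρ)) := by
  have h : Function.uncurry (capDensity n σ a ρ) = {p : ℝ × ℝ | a ≤ p.1 ∧ p.2 < ρ}.indicator
    fun p => ENNReal.ofReal (axialConst n σ * Real.exp (-p.2 ^ 2 / (2 * σ ^ 2))) := rfl
  rw [h]
  exact Measurable.indicator (by fun_prop) (measurableSet_cap a ρ)

/-- The probability that the noise lies in the cap region, as an integral over the half-plane. -/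
noncomputable def capMass (n : ℕ) (σ a ρ : ℝ) : ℝ≥0∞ :=
  ∫⁻ z : ℝ, ∫⁻ s in Ioi (0 : ℝ),
    ENNReal.ofReal (s ^ (n - 2)) * capDensity n σ a ρ z √(z ^ 2 + s ^ 2)

/-- The direction `u` of the cap is irrelevant, the noise being invariant under rotations. -/
theorem noise_cap {n : ℕ} (hn : 2 ≤ n) {σ : ℝ} (hσ : 0 < σ) (u : EuclideanSpace ℝ (Fin n))
    (hu : ‖u‖ = 1) (a ρ : ℝ) :
    noise n σ {x | a ≤ ⟪u, x⟫ ∧ ‖x‖ < ρ} = capMass n σ a ρ := by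
  obtain ⟨m, rfl⟩ : ∃ m, n = m + 1 := ⟨n - 1, by omega⟩
  have hm : 0 < m := by omega
  have hG := Gamma_half_pos hm
  set F : ℝ → ℝ → ℝ≥0∞ := fun z r => {p : ℝ × ℝ | a ≤ p.1 ∧ p.2 < ρ}.indicator
    (fun p => ENNReal.ofReal (noiseConst (m + 1) σ * Real.exp (-p.2 ^ 2 / (2 * σ ^ 2)))) (z, r)
    with hF
  have hFm : Measurable (Function.uncurry F) := by
    have h : Function.uncurry F = {p : ℝ × ℝ | a ≤ p.1 ∧ p.2 < ρ}.indicator fun p =>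
      ENNReal.ofReal (noiseConst (m + 1) σ * Real.exp (-p.2 ^ 2 / (2 * σ ^ 2))) := rfl
    rw [h]
    exact Measurable.indicator (by fun_prop) (measurableSet_cap a ρ)
  have hA : MeasurableSet {x : EuclideanSpace ℝ (Fin (m + 1)) | a ≤ ⟪u, x⟫ ∧ ‖x‖ < ρ} :=
    (measurableSet_cap a ρ).preimage
      (f := fun x : EuclideanSpace ℝ (Fin (m + 1)) => (⟪u, x⟫, ‖x‖)) (by fun_prop)
  rw [noise_eq_withDensity _ hσ, withDensity_apply _ hA, ← lintegral_indicator hA]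
  have h1 : ∀ x : EuclideanSpace ℝ (Fin (m + 1)),
      {x | a ≤ ⟪u, x⟫ ∧ ‖x‖ < ρ}.indicator (fun x => ENNReal.ofReal
        (noiseConst (m + 1) σ * Real.exp (-‖x‖ ^ 2 / (2 * σ ^ 2)))) x = F ⟪u, x⟫ ‖x‖ :=
    fun x => rfl
  simp_rw [h1]
  rw [lintegral_inner_norm m hm u hu F hFm, capMass,
    ← lintegral_const_mul' _ _ ENNReal.ofReal_ne_top]
  refine lintegral_congr fun z => ?_
  rw [← lintegral_const_mul' _ _ ENNReal.ofReal_ne_top]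
  refine lintegral_congr fun s => ?_
  rw [mul_left_comm]
  congr 1
  simp only [hF, capDensity, indicator_apply]
  split_ifs
  · rw [← ENNReal.ofReal_mul (by positivity), ← mul_assoc, noiseConst_mul_axial m hσ]
  · rw [mul_zero]

theorem noise_norm_ge {n : ℕ} (hn : 2 ≤ n) {σ : ℝ} (hσ : 0 < σ) {ρ : ℝ} (hρ : 0 ≤ ρ) :
    noise n σ {x | ρ ≤ ‖x‖} = ENNReal.ofReal (∫ r in Ioi ρ, radiusPdf n σ r) := by
  have hn0 : 0 < n := by omega
  have : Nonempty (Fin n) := ⟨⟨0, hn0⟩⟩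
  have hG := Gamma_half_pos hn0
  have hpi : 0 < √Real.pi := Real.sqrt_pos.2 Real.pi_pos
  have hA : MeasurableSet {x : EuclideanSpace ℝ (Fin n) | ρ ≤ ‖x‖} :=
    measurableSet_le measurable_const (by fun_prop)
  set f : ℝ → ℝ≥0∞ := (Ici ρ).indicator fun r =>
    ENNReal.ofReal (noiseConst n σ * Real.exp (-r ^ 2 / (2 * σ ^ 2))) with hf
  have hfm : Measurable f := Measurable.indicator (by fun_prop) measurableSet_Ici
  rw [noise_eq_withDensity _ hσ, withDensity_apply _ hA, ← lintegral_indicator hA]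
  have h1 : ∀ x : EuclideanSpace ℝ (Fin n), {x | ρ ≤ ‖x‖}.indicator (fun x => ENNReal.ofReal
      (noiseConst n σ * Real.exp (-‖x‖ ^ 2 / (2 * σ ^ 2)))) x = f ‖x‖ := fun x => rfl
  simp_rw [h1]
  rw [lintegral_fun_norm volume hfm, finrank_euclideanSpace_fin, finrank_mul_volume_ball n hn0,
    ofReal_integral_eq_lintegral_ofReal (integrable_radiusPdf n hσ).integrableOn
      ((ae_restrict_mem measurableSet_Ioi).mono fun r hr =>
        radiusPdf_nonneg hn0 hσ (hρ.trans (le_of_lt hr))),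
    Measure.restrict_congr_set (Ioi_ae_eq_Ici (a := (0 : ℝ))),
    ← lintegral_indicator measurableSet_Ici,
    Measure.restrict_congr_set (Ioi_ae_eq_Ici (a := ρ)), ← lintegral_indicator measurableSet_Ici,
    ← lintegral_const_mul' _ _ ENNReal.ofReal_ne_top]
  refine lintegral_congr fun r => ?_
  by_cases hr : r ∈ Ici ρ
  · have hr0 : r ∈ Ici (0 : ℝ) := hρ.trans hr
    have hr0' : 0 ≤ r := hr0
    have hc : 0 ≤ noiseConst n σ := by unfold noiseConst; positivity
    rw [hf, indicator_of_mem hr0, indicator_of_mem hr, indicator_of_mem hr,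
      ← ENNReal.ofReal_mul (by positivity), ← ENNReal.ofReal_mul (by positivity)]
    congr 1
    rw [noiseConst_eq n hσ, radiusPdf]
    field_simp
  · have hfr : f r = 0 := indicator_of_notMem hr _
    rw [indicator_of_notMem hr]
    simp [indicator_apply, hfr]

/-- In polar coordinates the cap region is `a < r < ρ`, `0 < φ ≤ arccos (a / r)`. -/
theorem capMass_eq_lintegral {n : ℕ} (hn : 2 ≤ n) {σ : ℝ} (hσ : 0 < σ) {a : ℝ} (ha : 0 < a)
    (ρ : ℝ) :
    capMass n σ a ρ =
      ∫⁻ r in Ioo 0 ρ, ENNReal.ofReal (capFraction n a r * radiusPdf n σ r) := by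
  have hC := axialConst_nonneg hn hσ
  rw [capMass, lintegral_halfPlane_polar _ _ (measurable_capDensity n σ a ρ),
    ← lintegral_indicator measurableSet_Ioi, ← lintegral_indicator measurableSet_Ioo]
  refine lintegral_congr fun r => ?_
  by_cases hr0 : r ∈ Ioi (0 : ℝ)
  swap
  · rw [indicator_of_notMem hr0, indicator_of_notMem fun h => hr0 h.1]
  have hr : 0 < r := hr0
  rw [indicator_of_mem hr0]
  by_cases hrρ : r < ρ
  swap
  · rw [indicator_of_notMem fun h => hrρ h.2]
    simp [capDensity, hrρ]
  rw [indicator_of_mem (show r ∈ Ioo 0 ρ from ⟨hr, hrρ⟩)]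
  -- a sphere of radius `r ≤ a` does not reach the cap; otherwise `a ≤ r cos φ` bounds the angle
  rcases le_or_gt r a with har | har
  · rw [capFraction_of_le n har, zero_mul, ENNReal.ofReal_zero]
    refine (setLIntegral_congr_fun measurableSet_Ioo (g := fun _ => 0) fun φ hφ => ?_).trans
      lintegral_zero
    have hcos : Real.cos φ < 1 := by
      rw [← Real.cos_zero]
      exact Real.cos_lt_cos_of_nonneg_of_le_pi le_rfl hφ.2.le hφ.1
    have : ¬ a ≤ r * Real.cos φ := by nlinarith
    simp [capDensity, this]
  · have hq : 0 < a / r := by positivity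
    have hq1 : a / r < 1 := (div_lt_one hr).2 har
    have hθ : Real.arccos (a / r) < Real.pi := by
      have := Real.arccos_lt_pi_div_two.2 hq
      linarith [Real.pi_pos]
    rw [capFraction, if_pos har, ← axialConst_mul_capFraction hn hσ,
      intervalIntegral.integral_of_le (Real.arccos_nonneg _), ← integral_const_mul,
      ofReal_integral_eq_lintegral_ofReal]
    · rw [← lintegral_indicator measurableSet_Ioo, ← lintegral_indicator measurableSet_Ioc]
      refine lintegral_congr fun φ => ?_
      by_cases hφ : φ ∈ Ioo 0 Real.pi
      · rw [indicator_of_mem hφ]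
        have hiff : a ≤ r * Real.cos φ ↔ φ ≤ Real.arccos (a / r) := by
          rw [mul_comm, ← div_le_iff₀ hr]
          conv_rhs => rw [← Real.arccos_cos hφ.1.le hφ.2.le]
          constructor
          · intro h
            exact Real.antitone_arccos h
          · intro h
            by_contra hc
            exact absurd h (not_le.2 (Real.strictAntiOn_arccos
              ⟨Real.neg_one_le_cos φ, Real.cos_le_one φ⟩ ⟨by linarith, hq1.le⟩ (not_le.1 hc)))
        by_cases hle : φ ≤ Real.arccos (a / r)
        · rw [indicator_of_mem (show φ ∈ Ioc 0 (Real.arccos (a / r)) from ⟨hφ.1, hle⟩), capDensity,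
            indicator_of_mem (show (r * Real.cos φ, r) ∈ {p : ℝ × ℝ | a ≤ p.1 ∧ p.2 < ρ} from
              ⟨hiff.2 hle, hrρ⟩), ← ENNReal.ofReal_mul
                (mul_nonneg (by positivity) (pow_nonneg (Real.sin_pos_of_mem_Ioo hφ).le _)),
            show n - 2 + 1 = n - 1 by omega]
          congr 1
          ring
        · rw [indicator_of_notMem fun h => hle h.2, capDensity, indicator_of_notMem, mul_zero]
          exact fun h => hle (hiff.1 h.1)
      · rw [indicator_of_notMem hφ, indicator_of_notMem]
        exact fun h => hφ ⟨h.1, h.2.trans_lt hθ⟩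
    · exact (Continuous.integrableOn_Icc (by fun_prop)).mono_set Ioc_subset_Icc_self
    · refine (ae_restrict_mem measurableSet_Ioc).mono fun φ hφ => ?_
      have := Real.sin_nonneg_of_nonneg_of_le_pi hφ.1.le (hφ.2.trans hθ.le)
      simp only [Pi.zero_apply]
      positivity

theorem toReal_capMass {n : ℕ} (hn : 2 ≤ n) {σ : ℝ} (hσ : 0 < σ) {a : ℝ} (ha : 0 < a)
    {ρ : ℝ} (hρ : 0 ≤ ρ) :
    (capMass n σ a ρ).toReal = ∫ r in (0 : ℝ)..ρ, capFraction n a r * radiusPdf n σ r := by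
  rw [capMass_eq_lintegral hn hσ ha, intervalIntegral.integral_of_le hρ,
    integral_eq_lintegral_of_nonneg_ae, restrict_Ioo_eq_restrict_Ioc]
  · exact (ae_restrict_mem measurableSet_Ioc).mono fun r hr =>
      mul_nonneg (capFraction_nonneg hn ha r) (radiusPdf_nonneg (by omega) hσ hr.1.le)
  · exact ((continuous_capFraction n ha).mul
      (continuous_radiusPdf n σ)).measurable.aestronglyMeasurable

theorem capMass_ne_top {n : ℕ} (hn : 2 ≤ n) {σ : ℝ} (hσ : 0 < σ) (a ρ : ℝ) :
    capMass n σ a ρ ≠ ∞ := by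
  have hp : IsProbabilityMeasure (noise n σ) :=
    Measure.isProbabilityMeasure_map (by fun_prop)
  rw [← noise_cap hn hσ (EuclideanSpace.single ⟨0, by omega⟩ 1) (by simp)]
  exact measure_ne_top _ _

/-- The substitution `y = r²` in the tail of the bound of Herzberg and Poltyrev. -/
theorem integral_sqNormPdf {n : ℕ} (hn : 2 ≤ n) (σ : ℝ) {ρ : ℝ} (hρ : 0 ≤ ρ) :
    ∫ y in Ioi (ρ ^ 2), sqNormPdf n σ y = ∫ r in Ioi ρ, radiusPdf n σ r := by
  have himg : (fun r : ℝ => r ^ 2) '' Ioi ρ = Ioi (ρ ^ 2) := by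
    ext y
    constructor
    · rintro ⟨r, hr, rfl⟩
      exact pow_lt_pow_left₀ hr hρ two_ne_zero
    · intro hy
      exact ⟨√y, (Real.lt_sqrt hρ).2 hy, Real.sq_sqrt ((sq_nonneg ρ).trans (le_of_lt hy))⟩
  rw [← himg, integral_image_eq_integral_abs_deriv_smul measurableSet_Ioi (f' := fun r => 2 * r)]
  · refine setIntegral_congr_fun measurableSet_Ioi fun r hr => ?_
    have hr0 : 0 < r := hρ.trans_lt hr
    have hpow : (r ^ 2) ^ ((n : ℝ) / 2 - 1) * r = r ^ (n - 1) := by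
      rw [← Real.rpow_natCast r 2, ← Real.rpow_mul hr0.le, ← Real.rpow_add_one hr0.ne',
        ← Real.rpow_natCast r (n - 1), Nat.cast_sub (by omega)]
      congr 1
      push_cast
      ring
    simp only [sqNormPdf, radiusPdf, smul_eq_mul, ← hpow, abs_of_pos (mul_pos two_pos hr0)]
    ring
  · intro r _
    simpa using (hasDerivAt_pow 2 r).hasDerivWithinAt
  · intro x hx y hy hxy
    exact (pow_left_inj₀ (hρ.trans (le_of_lt hx)) (hρ.trans (le_of_lt hy)) two_ne_zero).1 hxy

/-- The substitution `y = z² + s²` in the inner integral of Herzberg and Poltyrev. It removes the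
singularity that the joint density has at `y = z²` when `n = 2`. -/
theorem integral_jointPdf {n : ℕ} (hn : 2 ≤ n) (σ : ℝ) {z ρ : ℝ} (hz : 0 ≤ z) (hzρ : z ≤ ρ) :
    ∫ y in (z ^ 2)..(ρ ^ 2), jointPdf n σ z y =
      ∫ s in Ioo 0 √(ρ ^ 2 - z ^ 2),
        s ^ (n - 2) * (axialConst n σ * Real.exp (-(z ^ 2 + s ^ 2) / (2 * σ ^ 2))) := by
  have hsq : z ^ 2 ≤ ρ ^ 2 := pow_le_pow_left₀ hz hzρ 2
  have himg : (fun s : ℝ => z ^ 2 + s ^ 2) '' Ioo 0 √(ρ ^ 2 - z ^ 2) = Ioo (z ^ 2) (ρ ^ 2) := by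
    ext y
    constructor
    · rintro ⟨s, hs, rfl⟩
      have := (Real.lt_sqrt hs.1.le).1 hs.2
      have := pow_pos hs.1 2
      constructor <;> dsimp only <;> linarith
    · intro hy
      refine ⟨√(y - z ^ 2), ⟨Real.sqrt_pos.2 (by linarith [hy.1]),
        Real.sqrt_lt_sqrt (by linarith [hy.1]) (by linarith [hy.2])⟩, ?_⟩
      simp only [Real.sq_sqrt (show 0 ≤ y - z ^ 2 by linarith [hy.1])]
      ring
  rw [intervalIntegral.integral_of_le hsq, ← restrict_Ioo_eq_restrict_Ioc, ← himg,
    integral_image_eq_integral_abs_deriv_smul measurableSet_Ioo (f' := fun s => 2 * s)]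
  · refine setIntegral_congr_fun measurableSet_Ioo fun s hs => ?_
    have hs0 : 0 < s := hs.1
    have hpow : (s ^ 2) ^ (((n : ℝ) - 3) / 2) * s = s ^ (n - 2) := by
      rw [← Real.rpow_natCast s 2, ← Real.rpow_mul hs0.le, ← Real.rpow_add_one hs0.ne',
        ← Real.rpow_natCast s (n - 2), Nat.cast_sub hn]
      congr 1
      push_cast
      ring
    simp only [jointPdf, axialConst, smul_eq_mul, ← hpow, abs_of_pos (mul_pos two_pos hs0),
      add_sub_cancel_left]
    ring
  · intro s _
    simpa using ((hasDerivAt_pow 2 s).const_add (z ^ 2)).hasDerivWithinAt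
  · intro x hx y hy hxy
    exact (pow_left_inj₀ hx.1.le hy.1.le two_ne_zero).1 (add_left_cancel hxy)

/-- The term of Herzberg and Poltyrev is the probability of the cap region. The outer
integrals are compared in `ℝ≥0∞`; integrability is the finiteness of that probability. -/
theorem integral_integral_jointPdf {n : ℕ} (hn : 2 ≤ n) {σ : ℝ} (hσ : 0 < σ) {a ρ : ℝ}
    (ha : 0 < a) (haρ : a ≤ ρ) :
    ∫ z in a..ρ, ∫ y in (z ^ 2)..(ρ ^ 2), jointPdf n σ z y = (capMass n σ a ρ).toReal := by
  have hC := axialConst_nonneg hn hσ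
  have hρ : 0 < ρ := ha.trans_le haρ
  set G : ℝ → ℝ≥0∞ := fun z => ∫⁻ s in Ioi (0 : ℝ),
    ENNReal.ofReal (s ^ (n - 2)) * capDensity n σ a ρ z √(z ^ 2 + s ^ 2) with hG
  have hGm : Measurable G := by
    refine Measurable.lintegral_prod_right' (f := fun p : ℝ × ℝ =>
      ENNReal.ofReal (p.2 ^ (n - 2)) * capDensity n σ a ρ p.1 √(p.1 ^ 2 + p.2 ^ 2)) ?_
    refine Measurable.mul (by fun_prop) ((measurable_capDensity n σ a ρ).comp
      (f := fun p : ℝ × ℝ => (p.1, √(p.1 ^ 2 + p.2 ^ 2))) (by fun_prop))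
  have hout : ∀ z, z ∉ Icc a ρ → G z = 0 := by
    intro z hz
    refine (lintegral_congr fun s => ?_).trans lintegral_zero
    rw [capDensity, indicator_of_notMem, mul_zero]
    rintro ⟨h1, h2⟩
    refine hz ⟨h1, ?_⟩
    have hz0 : 0 ≤ z := ha.le.trans h1
    refine le_trans ?_ (le_of_lt h2)
    exact Real.le_sqrt_of_sq_le (by linarith [sq_nonneg s])
  -- the cap region lies above `z ∈ [a, ρ]`, since `|z| ≤ r < ρ` there
  have hset : ∫⁻ z in Ioc a ρ, G z = capMass n σ a ρ := by
    rw [Measure.restrict_congr_set Ioc_ae_eq_Icc, ← lintegral_indicator measurableSet_Icc, capMass]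
    refine lintegral_congr fun z => ?_
    by_cases hz : z ∈ Icc a ρ
    · rw [indicator_of_mem hz]
    · rw [indicator_of_notMem hz]
      exact (hout z hz).symm
  have hfin : ∀ᵐ z ∂volume.restrict (Ioc a ρ), G z < ∞ :=
    ae_lt_top hGm (by rw [hset]; exact capMass_ne_top hn hσ a ρ)
  rw [← hset, ← integral_toReal hGm.aemeasurable hfin, intervalIntegral.integral_of_le haρ]
  refine setIntegral_congr_fun measurableSet_Ioc fun z hz => ?_
  have hz0 : 0 < z := ha.trans hz.1
  rw [integral_jointPdf hn σ hz0.le hz.2, integral_eq_lintegral_of_nonneg_ae]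
  · congr 1
    rw [hG, ← lintegral_indicator measurableSet_Ioo]
    simp only
    rw [← lintegral_indicator measurableSet_Ioi]
    refine lintegral_congr fun s => ?_
    by_cases hs : s ∈ Ioi (0 : ℝ)
    · have hs0 : 0 < s := hs
      have hiff : √(z ^ 2 + s ^ 2) < ρ ↔ s < √(ρ ^ 2 - z ^ 2) := by
        rw [Real.sqrt_lt' hρ, Real.lt_sqrt hs0.le, lt_sub_iff_add_lt']
      rw [indicator_of_mem hs]
      by_cases h : s < √(ρ ^ 2 - z ^ 2)
      · rw [indicator_of_mem (show s ∈ Ioo 0 √(ρ ^ 2 - z ^ 2) from ⟨hs0, h⟩), capDensity,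
          indicator_of_mem (show (z, √(z ^ 2 + s ^ 2)) ∈ {p : ℝ × ℝ | a ≤ p.1 ∧ p.2 < ρ} from
            ⟨hz.1.le, hiff.2 h⟩), ← ENNReal.ofReal_mul (by positivity)]
        simp only [Real.sq_sqrt (show 0 ≤ z ^ 2 + s ^ 2 by positivity)]
      · rw [indicator_of_notMem fun h' => h h'.2, capDensity, indicator_of_notMem, mul_zero]
        exact fun h' => h (hiff.1 h'.2)
    · rw [indicator_of_notMem hs, indicator_of_notMem fun h => hs h.1]
  · refine (ae_restrict_mem measurableSet_Ioo).mono fun s hs => ?_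
    have := hs.1
    simp only [Pi.zero_apply]
    positivity
  · exact Measurable.aestronglyMeasurable (by fun_prop)

/-! ### Sums over the codewords of a linear code -/

open scoped Classical in
/-- The finite set of codewords. -/
noncomputable def codewords {n : ℕ} (C : Submodule (ZMod 2) (Fin n → ZMod 2)) :
    Finset (Fin n → ZMod 2) :=
  Finset.univ.filter fun c => c ∈ C

theorem mem_codewords {n : ℕ} {C : Submodule (ZMod 2) (Fin n → ZMod 2)} {c : Fin n → ZMod 2} :
    c ∈ codewords C ↔ c ∈ C := by
  simp [codewords]

theorem card_codewords {n : ℕ} (C : Submodule (ZMod 2) (Fin n → ZMod 2)) :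
    (codewords C).card = 2 ^ finrank (ZMod 2) C := by
  classical
  have h := Module.natCard_eq_pow_finrank (K := ZMod 2) (V := C)
  rw [Nat.card_zmod] at h
  rw [← h, Nat.card_eq_fintype_card]
  exact (Fintype.card_of_subtype _ fun c => mem_codewords).symm

theorem dist_bpsk {n : ℕ} (c c' : Fin n → ZMod 2) :
    dist (bpsk c) (bpsk c') = 2 * √(hammingNorm (c - c')) := by
  have h : ∀ a b : ZMod 2,
      dist (1 - 2 * (a.val : ℝ)) (1 - 2 * (b.val : ℝ)) ^ 2 = 4 * if a - b ≠ 0 then 1 else 0 := by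
    have h01 : ∀ a : ZMod 2, a = 0 ∨ a = 1 := by decide
    intro a b
    rcases h01 a with rfl | rfl <;> rcases h01 b with rfl | rfl <;>
      norm_num [Real.dist_eq, ZMod.val_one]
  rw [EuclideanSpace.dist_eq]
  simp only [bpsk, h]
  rw [← Finset.mul_sum, Finset.sum_boole, Real.sqrt_mul (by norm_num),
    show (4 : ℝ) = 2 ^ 2 by norm_num, Real.sqrt_sq zero_le_two]
  rfl

theorem bpsk_injective (n : ℕ) : Function.Injective (bpsk : (Fin n → ZMod 2) → _) := by
  intro c c' h
  have h' := dist_bpsk c c'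
  rw [h, dist_self] at h'
  have h0 : √(hammingNorm (c - c') : ℝ) = 0 := by linarith
  rw [Real.sqrt_eq_zero (Nat.cast_nonneg _), Nat.cast_eq_zero, hammingNorm_eq_zero] at h0
  exact sub_eq_zero.1 h0

open scoped Classical in
theorem bpskCode_eq_image {n : ℕ} (C : Submodule (ZMod 2) (Fin n → ZMod 2)) :
    bpskCode C = (codewords C).image bpsk := rfl

open scoped Classical in
/-- By linearity, every codeword sees the same distances to the other codewords. -/
theorem sum_dist_bpskCode {n : ℕ} (C : Submodule (ZMod 2) (Fin n → ZMod 2))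
    {s : EuclideanSpace ℝ (Fin n)} (hs : s ∈ bpskCode C) (h : ℝ → ℝ) :
    ∑ t ∈ (bpskCode C).erase s, h (dist s t) =
      ∑ c ∈ (codewords C).erase 0, h (2 * √(hammingNorm c)) := by
  rw [bpskCode_eq_image] at hs ⊢
  obtain ⟨c, hc, rfl⟩ := Finset.mem_image.1 hs
  rw [mem_codewords] at hc
  rw [← Finset.image_erase (bpsk_injective n), Finset.sum_image (bpsk_injective n).injOn]
  refine Finset.sum_bij' (fun c' _ => c - c') (fun c' _ => c - c') ?_ ?_ ?_ ?_ ?_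
  · intro c' hc'
    rw [Finset.mem_erase, mem_codewords] at hc' ⊢
    exact ⟨sub_ne_zero.2 hc'.1.symm, C.sub_mem hc hc'.2⟩
  · intro c' hc'
    rw [Finset.mem_erase, mem_codewords] at hc' ⊢
    exact ⟨fun h => hc'.1 (sub_eq_self.1 h), C.sub_mem hc hc'.2⟩
  · intro c' _
    exact sub_sub_cancel c c'
  · intro c' _
    exact sub_sub_cancel c c'
  · intro c' _
    rw [dist_bpsk]

open scoped Classical in
/-- The sum over the weights counts each nonzero codeword once. -/
theorem sum_weightDist {n : ℕ} (C : Submodule (ZMod 2) (Fin n → ZMod 2)) (h : ℕ → ℝ) :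
    ∑ d ∈ Finset.Icc 1 n, (weightDist C d : ℝ) * h d =
      ∑ c ∈ (codewords C).erase 0, h (hammingNorm c) := by
  have hmaps : ∀ c ∈ (codewords C).erase 0, hammingNorm c ∈ Finset.Icc 1 n := by
    intro c hc
    rw [Finset.mem_Icc]
    refine ⟨hammingNorm_pos_iff.2 (Finset.ne_of_mem_erase hc), ?_⟩
    simpa using hammingNorm_le_card_fintype (x := c)
  rw [← Finset.sum_fiberwise_of_maps_to hmaps]
  refine Finset.sum_congr rfl fun d hd => ?_
  rw [Finset.sum_congr rfl fun c hc => by rw [(Finset.mem_filter.1 hc).2], Finset.sum_const,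
    nsmul_eq_mul, weightDist]
  congr 3
  ext c
  simp only [Finset.mem_filter, Finset.mem_univ, true_and, Finset.mem_erase, mem_codewords]
  constructor
  · rintro ⟨hc, rfl⟩
    exact ⟨⟨hammingNorm_pos_iff.1 (Finset.mem_Icc.1 hd).1, hc⟩, rfl⟩
  · rintro ⟨⟨_, hc⟩, rfl⟩
    exact ⟨hc, rfl⟩

theorem unionBound_eq_sum_codewords {n : ℕ} (C : Submodule (ZMod 2) (Fin n → ZMod 2)) (r : ℝ) :
    unionBound C r = ∑ c ∈ (codewords C).erase 0, capFraction n √(hammingNorm c) r :=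
  sum_weightDist C fun d => p₂ n r d

open scoped Classical in
/-- Grouping the pairs of codewords by their distance gives back the union bound in terms of the
distance spectrum. -/
theorem generalUnionBound_eq_sum_pairs {n : ℕ} (S : Finset (EuclideanSpace ℝ (Fin n))) (r : ℝ) :
    generalUnionBound S r =
      ∑ s ∈ S, (1 / (S.card : ℝ)) * ∑ t ∈ S.erase s, pairwise n r (dist s t) := by
  simp only [generalUnionBound, distSpectrum, Finset.sum_mul]
  rw [Finset.sum_comm]
  refine Finset.sum_congr rfl fun s hs => ?_
  simp only [mul_assoc]
  rw [← Finset.mul_sum]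
  congr 1
  have hmaps : ∀ t ∈ S.erase s, dist s t ∈ distances S := fun t ht =>
    Finset.mem_image.2 ⟨(s, t), Finset.mem_offDiag.2
      ⟨hs, Finset.mem_of_mem_erase ht, (Finset.ne_of_mem_erase ht).symm⟩, rfl⟩
  rw [← Finset.sum_fiberwise_of_maps_to hmaps]
  refine Finset.sum_congr rfl fun δ hδ => ?_
  rw [Finset.sum_congr rfl fun t ht => by rw [(Finset.mem_filter.1 ht).2], Finset.sum_const,
    nsmul_eq_mul, distCount]
  congr 3
  ext t
  obtain ⟨p, hp, rfl⟩ := Finset.mem_image.1 hδ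
  have hpos : 0 < dist p.1 p.2 := dist_pos.2 (Finset.mem_offDiag.1 hp).2.2
  simp only [Finset.mem_filter, Finset.mem_erase]
  constructor
  · rintro ⟨ht, h⟩
    refine ⟨⟨?_, ht⟩, h⟩
    rintro rfl
    rw [dist_self] at h
    exact hpos.ne h
  · rintro ⟨⟨_, ht⟩, h⟩
    exact ⟨ht, h⟩

theorem average_const {α : Type*} {S : Finset α} (hS : S.Nonempty) (b : ℝ) :
    ∑ _s ∈ S, (1 / (S.card : ℝ)) * b = b := by
  have : (S.card : ℝ) ≠ 0 := by exact_mod_cast hS.card_ne_zero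
  rw [Finset.sum_const, nsmul_eq_mul]
  field_simp

theorem bpskCode_nonempty {n : ℕ} (C : Submodule (ZMod 2) (Fin n → ZMod 2)) :
    (bpskCode C).Nonempty := by
  classical
  exact Finset.Nonempty.image ⟨0, mem_codewords.2 C.zero_mem⟩ _

theorem generalUnionBound_bpskCode {n : ℕ} (C : Submodule (ZMod 2) (Fin n → ZMod 2)) (r : ℝ) :
    generalUnionBound (bpskCode C) r = unionBound C r := by
  classical
  rw [generalUnionBound_eq_sum_pairs, Finset.sum_congr rfl fun s hs => by
    rw [sum_dist_bpskCode C hs (pairwise n r)], average_const (bpskCode_nonempty C),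
    unionBound_eq_sum_codewords]
  simp [pairwise_eq_capFraction]

/-! ### The error probability and the equality of the bounds -/

theorem sqrt_hammingNorm_pos {n : ℕ} {C : Submodule (ZMod 2) (Fin n → ZMod 2)}
    {c : Fin n → ZMod 2} (hc : c ∈ (codewords C).erase 0) : 0 < √(hammingNorm c : ℝ) :=
  Real.sqrt_pos.2 (by exact_mod_cast hammingNorm_pos_iff.2 (Finset.ne_of_mem_erase hc))

/-- If the noise takes the received vector to a codeword `t` other than the transmitted `s`, its
component in the direction of `t - s` is at least half of their distance. -/
theorem half_dist_le_inner {E : Type*} [NormedAddCommGroup E] [InnerProductSpace ℝ E] {s t z : E}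
    (hst : t ≠ s) (h : ‖s + z - t‖ ≤ ‖z‖) :
    dist s t / 2 ≤ ⟪‖t - s‖⁻¹ • (t - s), z⟫ := by
  have hpos : 0 < ‖t - s‖ := norm_pos_iff.2 (sub_ne_zero.2 hst)
  have h1 : ‖z - (t - s)‖ ^ 2 ≤ ‖z‖ ^ 2 := by
    rw [show z - (t - s) = s + z - t by abel]
    exact pow_le_pow_left₀ (norm_nonneg _) h 2
  rw [norm_sub_sq_real, real_inner_comm] at h1
  rw [real_inner_smul_left, dist_comm, dist_eq_norm, inv_mul_eq_div, div_le_div_iff₀ two_pos hpos]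
  nlinarith

open scoped Classical in
/-- The union bound inside the ball of radius `ρ`, and the trivial bound outside. The error event
need not be measurable, as `dec` is arbitrary on ties; only the covering sets have to be. -/
theorem noise_error_le {n : ℕ} (hn : 2 ≤ n) {S : Finset (EuclideanSpace ℝ (Fin n))}
    {dec : EuclideanSpace ℝ (Fin n) → EuclideanSpace ℝ (Fin n)} (hdec : IsMLDecoder S dec)
    {s : EuclideanSpace ℝ (Fin n)} (hs : s ∈ S) {σ : ℝ} (hσ : 0 < σ) {ρ : ℝ} (hρ : 0 ≤ ρ) :
    (noise n σ).real {z | dec (s + z) ≠ s} ≤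
      ∑ t ∈ S.erase s, (capMass n σ (dist s t / 2) ρ).toReal + ∫ r in Ioi ρ, radiusPdf n σ r := by
  set A : EuclideanSpace ℝ (Fin n) → Set (EuclideanSpace ℝ (Fin n)) := fun t =>
    {z | dist s t / 2 ≤ ⟪‖t - s‖⁻¹ • (t - s), z⟫ ∧ ‖z‖ < ρ} with hA
  -- inside the ball an error means that `dec (s + z)` is at least as close as `s`
  have hsub : {z | dec (s + z) ≠ s} ⊆ (⋃ t ∈ S.erase s, A t) ∪ {z | ρ ≤ ‖z‖} := by
    intro z hz
    rcases le_or_gt ρ ‖z‖ with h | h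
    · exact Or.inr h
    · obtain ⟨h1, h2⟩ := hdec (s + z)
      refine Or.inl (mem_iUnion₂.2 ⟨dec (s + z), Finset.mem_erase.2 ⟨hz, h1⟩,
        half_dist_le_inner hz ?_, h⟩)
      simpa using h2 s hs
  have htail : 0 ≤ ∫ r in Ioi ρ, radiusPdf n σ r :=
    setIntegral_nonneg measurableSet_Ioi fun r hr =>
      radiusPdf_nonneg (by omega) hσ (hρ.trans (le_of_lt hr))
  have hle : noise n σ {z | dec (s + z) ≠ s} ≤
      ∑ t ∈ S.erase s, capMass n σ (dist s t / 2) ρ +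
        ENNReal.ofReal (∫ r in Ioi ρ, radiusPdf n σ r) := by
    refine (measure_mono hsub).trans ((measure_union_le _ _).trans ?_)
    rw [noise_norm_ge hn hσ hρ]
    gcongr
    refine (measure_biUnion_finset_le _ _).trans (Finset.sum_le_sum fun t ht => ?_)
    have hne : t - s ≠ 0 := sub_ne_zero.2 (Finset.ne_of_mem_erase ht)
    exact (noise_cap hn hσ _ (by simpa using norm_smul_inv_norm (𝕜 := ℝ) hne) _ _).le
  have hfin : ∀ t ∈ S.erase s, capMass n σ (dist s t / 2) ρ ≠ ∞ := fun t _ =>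
    capMass_ne_top hn hσ _ _
  rw [measureReal_def, ← ENNReal.toReal_sum hfin, ← ENNReal.toReal_ofReal htail,
    ← ENNReal.toReal_add (ENNReal.sum_ne_top.2 hfin) ENNReal.ofReal_ne_top]
  exact ENNReal.toReal_mono
    (ENNReal.add_ne_top.2 ⟨ENNReal.sum_ne_top.2 hfin, ENNReal.ofReal_ne_top⟩) hle

theorem continuous_p₂ (n : ℕ) {d : ℕ} (hd : 1 ≤ d) : Continuous fun r => p₂ n r d :=
  continuous_capFraction n (Real.sqrt_pos.2 (by exact_mod_cast hd))

/-- The cap masses are the contributions of the single weights to the sphere bound. -/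
theorem sphereBound_eq_sum_capMass {n : ℕ} (hn : 2 ≤ n)
    (C : Submodule (ZMod 2) (Fin n → ZMod 2)) {σ : ℝ} (hσ : 0 < σ) {ρ : ℝ} (hρ : 0 ≤ ρ) :
    sphereBound C σ ρ = ∑ d ∈ Finset.Icc 1 n, (weightDist C d : ℝ) * (capMass n σ √d ρ).toReal +
      ∫ r in Ioi ρ, radiusPdf n σ r := by
  rw [sphereBound]
  congr 1
  simp only [unionBound, Finset.sum_mul]
  rw [intervalIntegral.integral_finsetSum]
  · refine Finset.sum_congr rfl fun d hd => ?_
    have hd0 : 0 < √(d : ℝ) := Real.sqrt_pos.2 (by exact_mod_cast (Finset.mem_Icc.1 hd).1)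
    rw [toReal_capMass hn hσ hd0 hρ, ← intervalIntegral.integral_const_mul]
    simp only [mul_assoc, p₂_eq_capFraction]
  · intro d hd
    exact ((continuous_const.mul (continuous_p₂ n (Finset.mem_Icc.1 hd).1)).mul
      (continuous_radiusPdf n σ)).intervalIntegrable _ _

theorem errorProb_le_sphereBound {n : ℕ} (hn : 2 ≤ n) (C : Submodule (ZMod 2) (Fin n → ZMod 2))
    {dec : EuclideanSpace ℝ (Fin n) → EuclideanSpace ℝ (Fin n)}
    (hdec : IsMLDecoder (bpskCode C) dec) {σ : ℝ} (hσ : 0 < σ) {ρ : ℝ} (hρ : 0 ≤ ρ) :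
    errorProb (bpskCode C) dec σ ≤ sphereBound C σ ρ := by
  classical
  rw [sphereBound_eq_sum_capMass hn C hσ hρ, sum_weightDist C fun d => (capMass n σ √d ρ).toReal,
    ← average_const (bpskCode_nonempty C) (_ + _)]
  refine Finset.sum_le_sum fun s hs => ?_
  refine mul_le_mul_of_nonneg_left ((noise_error_le hn hdec hs hσ hρ).trans_eq ?_) (by positivity)
  rw [sum_dist_bpskCode C hs fun δ => (capMass n σ (δ / 2) ρ).toReal]
  simp

theorem herzbergPoltyrevBound_eq_sphereBound {n : ℕ} (hn : 2 ≤ n)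
    (C : Submodule (ZMod 2) (Fin n → ZMod 2)) {σ : ℝ} (hσ : 0 < σ) {ρ : ℝ} (hρ : 0 ≤ ρ) :
    herzbergPoltyrevBound C σ ρ = sphereBound C σ ρ := by
  rw [sphereBound_eq_sum_capMass hn C hσ hρ, herzbergPoltyrevBound, integral_sqNormPdf hn σ hρ,
    Finset.sum_filter]
  congr 1
  refine Finset.sum_congr rfl fun d hd => ?_
  have hd0 : 0 < √(d : ℝ) := Real.sqrt_pos.2 (by exact_mod_cast (Finset.mem_Icc.1 hd).1)
  split_ifs with h
  · rw [integral_integral_jointPdf hn hσ hd0 h.le]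
  -- for `ρ ≤ √d` the ball does not reach the cap, and the term is `0` on the other side too
  · rw [toReal_capMass hn hσ hd0 hρ, intervalIntegral.integral_of_le hρ,
      setIntegral_congr_fun (g := fun _ => (0 : ℝ)) measurableSet_Ioc fun r hr => ?_]
    · simp
    · simp only [capFraction_of_le n (hr.2.trans (not_lt.1 h)), zero_mul]

theorem herzbergPoltyrevRadius_iff {n : ℕ} (hn : 2 ≤ n)
    (C : Submodule (ZMod 2) (Fin n → ZMod 2)) (r : ℝ) :
    HerzbergPoltyrevRadius C r ↔ unionBound C r = 1 := by
  have hc : √Real.pi * Real.Gamma (((n : ℝ) - 1) / 2) / Real.Gamma ((n : ℝ) / 2) =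
      (capConst n)⁻¹ := by rw [capConst, inv_div]
  have hU : unionBound C r = capConst n *
      ∑ d ∈ (Finset.Icc 1 n).filter (fun d : ℕ => √d < r), (weightDist C d : ℝ) *
        ∫ φ in (0 : ℝ)..Real.arccos (√d / r), Real.sin φ ^ (n - 2) := by
    rw [unionBound, Finset.sum_filter, Finset.mul_sum]
    refine Finset.sum_congr rfl fun d _ => ?_
    rw [p₂_eq_capFraction, capFraction]
    split_ifs <;> ring
  rw [HerzbergPoltyrevRadius, hc, hU, mul_comm (capConst n), ← eq_div_iff (capConst_pos hn).ne',
    one_div]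

theorem continuous_unionBound {n : ℕ} (C : Submodule (ZMod 2) (Fin n → ZMod 2)) :
    Continuous (unionBound C) :=
  continuous_finsetSum _ fun _ hd =>
    continuous_const.mul (continuous_p₂ n (Finset.mem_Icc.1 hd).1)

theorem monotone_unionBound {n : ℕ} (hn : 2 ≤ n) (C : Submodule (ZMod 2) (Fin n → ZMod 2)) :
    Monotone (unionBound C) := by
  intro r s hrs
  simp only [unionBound_eq_sum_codewords]
  exact Finset.sum_le_sum fun c hc => monotone_capFraction hn (sqrt_hammingNorm_pos hc) hrs

theorem unionBound_nonneg {n : ℕ} (hn : 2 ≤ n) (C : Submodule (ZMod 2) (Fin n → ZMod 2)) (r : ℝ) :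
    0 ≤ unionBound C r := by
  rw [unionBound_eq_sum_codewords]
  exact Finset.sum_nonneg fun c hc => capFraction_nonneg hn (sqrt_hammingNorm_pos hc) r

theorem integrable_min_unionBound {n : ℕ} (hn : 2 ≤ n)
    (C : Submodule (ZMod 2) (Fin n → ZMod 2)) {σ : ℝ} (hσ : 0 < σ) :
    Integrable fun r => min (unionBound C r) 1 * radiusPdf n σ r := by
  refine (integrable_radiusPdf n hσ).bdd_mul (c := 1)
    ((continuous_unionBound C).min continuous_const).aestronglyMeasurable
    (Filter.Eventually.of_forall fun r => ?_)
  rw [Real.norm_of_nonneg (le_min (unionBound_nonneg hn C r) zero_le_one)]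
  exact min_le_right _ _

theorem kasamiBound_eq_add {n : ℕ} (hn : 2 ≤ n) (C : Submodule (ZMod 2) (Fin n → ZMod 2)) {σ : ℝ}
    (hσ : 0 < σ) {ρ : ℝ} (hρ : 0 ≤ ρ) :
    kasamiBound C σ = (∫ r in (0 : ℝ)..ρ, min (unionBound C r) 1 * radiusPdf n σ r) +
      ∫ r in Ioi ρ, min (unionBound C r) 1 * radiusPdf n σ r := by
  have hi := integrable_min_unionBound hn C hσ
  rw [kasamiBound, intervalIntegral.integral_of_le hρ, ← Ioc_union_Ioi_eq_Ioi hρ,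
    setIntegral_union (Ioc_disjoint_Ioi le_rfl) measurableSet_Ioi hi.integrableOn hi.integrableOn]

/-- For every `ρ` the integrands of the sphere bound, `f_u` inside the ball and `1` outside,
dominate `min f_u 1`. -/
theorem kasamiBound_le_sphereBound {n : ℕ} (hn : 2 ≤ n)
    (C : Submodule (ZMod 2) (Fin n → ZMod 2)) {σ : ℝ} (hσ : 0 < σ) {ρ : ℝ} (hρ : 0 ≤ ρ) :
    kasamiBound C σ ≤ sphereBound C σ ρ := by
  have hi := integrable_min_unionBound hn C hσ
  rw [kasamiBound_eq_add hn C hσ hρ, sphereBound]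
  refine add_le_add ?_ ?_
  · refine intervalIntegral.integral_mono_on hρ hi.intervalIntegrable
      (((continuous_unionBound C).mul (continuous_radiusPdf n σ)).intervalIntegrable _ _)
      fun r hr => ?_
    exact mul_le_mul_of_nonneg_right (min_le_left _ _) (radiusPdf_nonneg (by omega) hσ hr.1)
  · refine setIntegral_mono_on hi.integrableOn (integrable_radiusPdf n hσ).integrableOn
      measurableSet_Ioi fun r hr => ?_
    exact mul_le_of_le_one_left (radiusPdf_nonneg (by omega) hσ (hρ.trans (le_of_lt hr)))
      (min_le_right _ _)

/-- At the radius where the monotone function `f_u` crosses `1`, cutting off at the radius and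
cutting off at the value `1` are the same. -/
theorem kasamiBound_eq_sphereBound {n : ℕ} (hn : 2 ≤ n)
    (C : Submodule (ZMod 2) (Fin n → ZMod 2)) {σ : ℝ} (hσ : 0 < σ) {r₁ : ℝ} (hr₁ : 0 ≤ r₁)
    (h : unionBound C r₁ = 1) :
    kasamiBound C σ = sphereBound C σ r₁ := by
  rw [kasamiBound_eq_add hn C hσ hr₁, sphereBound]
  congr 1
  · refine intervalIntegral.integral_congr fun r hr => ?_
    rw [uIcc_of_le hr₁] at hr
    simp only [min_eq_left (h ▸ monotone_unionBound hn C hr.2)]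
  · refine setIntegral_congr_fun measurableSet_Ioi fun r hr => ?_
    simp only [min_eq_right (h ▸ monotone_unionBound hn C (le_of_lt hr)), one_mul]

theorem generalSphereBound_bpskCode {n : ℕ} (C : Submodule (ZMod 2) (Fin n → ZMod 2)) (σ : ℝ) :
    generalSphereBound (bpskCode C) σ = kasamiBound C σ := by
  simp only [generalSphereBound, kasamiBound, generalUnionBound_bpskCode]

theorem exists_unique_unionBound_eq_one {n : ℕ} (hn : 2 ≤ n)
    (C : Submodule (ZMod 2) (Fin n → ZMod 2)) (hk : 1 < finrank (ZMod 2) C) :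
    ∃ r₁ : ℝ, 0 < r₁ ∧ ∀ r : ℝ, unionBound C r = 1 ↔ r = r₁ := by
  simp only [unionBound_eq_sum_codewords]
  refine exists_unique_radius hn _ (fun c => √(hammingNorm c : ℝ))
    (fun c hc => sqrt_hammingNorm_pos hc) ?_
  have h4 : 2 ^ 2 ≤ 2 ^ finrank (ZMod 2) C := Nat.pow_le_pow_right two_pos hk
  rw [Finset.card_erase_of_mem (mem_codewords.2 C.zero_mem), card_codewords]
  omega

end SphereBound

theorem mainTheorem8 {n : ℕ} (C : Submodule (ZMod 2) (Fin n → ZMod 2))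
    (hk : 1 < Module.finrank (ZMod 2) C) :
    ∃ r₁ : ℝ, 0 < r₁ ∧
      -- `r₁` is the unique solution of the radius equation; it is chosen before `σ`
      (∀ r : ℝ, SphereBound.unionBound C r = 1 ↔ r = r₁) ∧
      -- the radius equation is the one of Herzberg and Poltyrev
      (∀ r : ℝ, SphereBound.HerzbergPoltyrevRadius C r ↔ SphereBound.unionBound C r = 1) ∧
      -- the union bound of the general theory is `f_u`
      (∀ r : ℝ, SphereBound.generalUnionBound (SphereBound.bpskCode C) r =
        SphereBound.unionBound C r) ∧
      ∀ σ : ℝ, 0 < σ →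
        -- the bound on the error probability of maximum-likelihood decoding
        (∀ dec : EuclideanSpace ℝ (Fin n) → EuclideanSpace ℝ (Fin n),
          SphereBound.IsMLDecoder (SphereBound.bpskCode C) dec →
          SphereBound.errorProb (SphereBound.bpskCode C) dec σ ≤
            SphereBound.sphereBound C σ r₁) ∧
        -- the generalized sphere bound reduces to it
        SphereBound.generalSphereBound (SphereBound.bpskCode C) σ =
          SphereBound.sphereBound C σ r₁ ∧
        -- the radius `r₁` is optimal
        (∀ ρ : ℝ, 0 ≤ ρ →
          SphereBound.sphereBound C σ r₁ ≤ SphereBound.sphereBound C σ ρ) ∧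
        -- it is the bound of Kasami et al.
        SphereBound.kasamiBound C σ = SphereBound.sphereBound C σ r₁ ∧
        -- it is the bound of Herzberg and Poltyrev, at the optimal and at every other radius
        (∀ ρ : ℝ, 0 ≤ ρ →
          SphereBound.herzbergPoltyrevBound C σ ρ = SphereBound.sphereBound C σ ρ) := by
  have hn : 2 ≤ n := by
    have h := Submodule.finrank_le C
    rw [Module.finrank_fin_fun] at h
    omega
  obtain ⟨r₁, hr₁, huniq⟩ := SphereBound.exists_unique_unionBound_eq_one hn C hk
  have hK : ∀ σ : ℝ, 0 < σ → SphereBound.kasamiBound C σ = SphereBound.sphereBound C σ r₁ :=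
    fun σ hσ => SphereBound.kasamiBound_eq_sphereBound hn C hσ hr₁.le ((huniq r₁).2 rfl)
  refine ⟨r₁, hr₁, huniq, SphereBound.herzbergPoltyrevRadius_iff hn C,
    SphereBound.generalUnionBound_bpskCode C, fun σ hσ => ⟨fun dec hdec => ?_, ?_, ?_, hK σ hσ,
      fun ρ hρ => SphereBound.herzbergPoltyrevBound_eq_sphereBound hn C hσ hρ⟩⟩
  · exact SphereBound.errorProb_le_sphereBound hn C hdec hσ hr₁.le
  · rw [SphereBound.generalSphereBound_bpskCode, hK σ hσ]
  · intro ρ hρ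
    rw [← hK σ hσ]
    exact SphereBound.kasamiBound_le_sphereBound hn C hσ hρ
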